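/- Let $X$ and $Y$ be complex Banach spaces, let $A\in B(X)$, $B\in B(Y)$ and $C\in B(Y,X)$ be bounded linear operators, and let $M_C=\begin{pmatrix}A&C\\0&B\end{pmatrix}$ on $X\oplus Y$, that is, $M_C(x,y)=(Ax+Cy,\,By)$. Then $$\sigma_D(M_C)\cup\bigl(S(A^*)\cap S(B)\bigr)=\sigma_D(A)\cup\sigma_D(B).$$ Here $A^*$ is the dual operator of $A$ on the dual space $X^*$, given by $A^*\varphi=\varphi\circ A$. For a bounded linear operator $T$ on a complex Banach space $Z$: - $T$ is Drazin invertible if there are a bounded linear operator $T^D$ on $Z$ and an integer $k\ge 0$ with $TT^D=T^DT$, $T^DTT^D=T^D$ and $T^{k+1}T^D=T^k$; and $\sigma_D(T)=\{\lambda\in\mathbb{C}: T-\lambda I\text{ is not Drazin invertible}\}$ is the Drazin spectrum. - $T$ has the single valued extension property (SVEP) at $\lambda\in\mathbb{C}$ if there is $r>0$ such that for every open subset $V$ of the open disc $D(\lambda,r)$ the only analytic function $f:V\to Z$ with $(T-\mu I)f(\mu)=0$ for all $\mu\in V$ is $f\equiv 0$; and $S(T)=\{\lambda\in\mathbb{C}: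 T\text{ fails to have the SVEP at }\lambda\}$. -/

import Mathlib

noncomputable section

namespace UpperTriangular

/-- `T ∈ B(X)` is Drazin invertible: there are `S ∈ B(X)` and `k ≥ 0` with
`T S = S T`, `S T S = S` and `T ^ (k + 1) S = T ^ k`. -/
def IsDrazinInvertible {X : Type*} [NormedAddCommGroup X] [NormedSpace ℂ X]
    (T : X →L[ℂ] X) : Prop :=
  ∃ S : X →L[ℂ] X, T * S = S * T ∧ S * T * S = S ∧ ∃ k : ℕ, T ^ (k + 1) * S = T ^ k

/-- The Drazin spectrum `σ_D(T)`. -/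
def drazinSpectrum {X : Type*} [NormedAddCommGroup X] [NormedSpace ℂ X]
    (T : X →L[ℂ] X) : Set ℂ :=
  {z | ¬ IsDrazinInvertible (T - z • ContinuousLinearMap.id ℂ X)}

/-- `T` has the single valued extension property at `z`: for some `r > 0` and every open subset `V`
of the open disc `D(z, r)`, the only analytic solution `f : V → X` of
`(T - μ) f(μ) = 0` for all `μ ∈ V` is `f ≡ 0` on `V`. -/
def HasSVEPAt {X : Type*} [NormedAddCommGroup X] [NormedSpace ℂ X]
    (T : X →L[ℂ] X) (z : ℂ) : Prop :=
  ∃ r : ℝ, 0 < r ∧ ∀ V : Set ℂ, IsOpen V → V ⊆ Metric.ball z r →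
    ∀ f : ℂ → X, AnalyticOnNhd ℂ f V →
      (∀ μ ∈ V, (T - μ • ContinuousLinearMap.id ℂ X) (f μ) = 0) → ∀ μ ∈ V, f μ = 0

/-- `S(T)`, the set of points at which `T` fails to have the single valued extension property. -/
def svepFailureSet {X : Type*} [NormedAddCommGroup X] [NormedSpace ℂ X]
    (T : X →L[ℂ] X) : Set ℂ :=
  {z | ¬ HasSVEPAt T z}

/-- The Banach space dual operator `T* : X* → X*`, `T* φ = φ ∘ T` (complex linear, with no
conjugation). -/
def dualOperator {X : Type*} [NormedAddCommGroup X] [NormedSpace ℂ X]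
    (T : X →L[ℂ] X) : StrongDual ℂ X →L[ℂ] StrongDual ℂ X :=
  ContinuousLinearMap.precomp ℂ T

/-- The operator matrix `M_C` on `X ⊕ Y` (realised as `X × Y`):
`M_C (x, y) = (A x + C y, B y)`. -/
def operatorMatrix {X Y : Type*} [NormedAddCommGroup X] [NormedSpace ℂ X]
    [NormedAddCommGroup Y] [NormedSpace ℂ Y]
    (A : X →L[ℂ] X) (C : Y →L[ℂ] X) (B : Y →L[ℂ] Y) : (X × Y) →L[ℂ] (X × Y) :=
  (A.coprod C).prod (B.comp (ContinuousLinearMap.snd ℂ X Y))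

end UpperTriangular

end

/-!
The idea is that the three operators `A`, `B` and `M_C` control one another through invertibility
at all points near a given `z`, and that Drazin invertibility of `T - z` is stronger than
invertibility of `T - μ` for `μ ≠ z` near `z` (`eventually_isUnit_sub_smul_id`).

If `A - z` and `B - z` are Drazin invertible, so is `M_C - z`
(`isDrazinInvertible_operatorMatrix`): an element `t` of a ring is Drazin invertible as soon as
`t ^ n` lies in both `t ^ (n + 1) R` and `R t ^ (n + 1)`, and for an upper triangular matrix this
can be checked up to an off-diagonal error, which one more power of `M_C` absorbs. Moreover `B`
then has the SVEP at `z`, since an analytic solution of `(B - μ) f(μ) = 0` vanishes off `z`,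
hence everywhere by continuity.

Conversely, let `M_C - z` be Drazin invertible. For `μ ≠ z` near `z` the operator `M_C - μ` is
invertible, so `A - μ` has a left inverse and `B - μ` has a right inverse. An operator with the
SVEP at `z` and a right inverse of `T - μ` has `T - μ` injective
(`HasSVEPAt.eventually_eq_zero`): a kernel vector `x` would extend to the solution
`μ' ↦ (1 - (μ' - μ) R)⁻¹ x`. Applied to `B`, this makes `B - μ` injective; applied to `A*`, it makes
`A - μ` invertible, by the Hahn-Banach theorem, and again `B - μ` is injective. Injectivity of
`B - μ` says that `(M_C - μ)⁻¹` is upper triangular. The Drazin inverse of `M_C - z` is a limit of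
polynomials in `M_C - z` and these inverses (`tendsto_inverse_pow_mul_pow`), so it is upper
triangular as well, and its diagonal entries are Drazin inverses of `A - z` and `B - z`.
-/

open Filter Topology

namespace UpperTriangular

/-! ### Drazin inverses in a ring -/

section Ring

variable {R : Type*} [Ring R]

/-- A strongly π-regular element of a ring is Drazin invertible. The inverse is
`t ^ n * a ^ (n + 1) = b ^ (n + 1) * t ^ n`. -/
theorem exists_drazin_inverse_of_pow_eq {t a b : R} {n : ℕ}
    (ha : t ^ n = t ^ (n + 1) * a) (hb : t ^ n = b * t ^ (n + 1)) :
    ∃ s : R, t * s = s * t ∧ s * t * s = s ∧ ∃ k : ℕ, t ^ (k + 1) * s = t ^ k := by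
  have hab : t ^ n * a = b * t ^ n := by
    calc t ^ n * a = b * t ^ (n + 1) * a := by rw [← hb]
      _ = b * t ^ n := by rw [mul_assoc, ← ha]
  have hshift : ∀ j : ℕ, t ^ n * a ^ j = b ^ j * t ^ n := by
    intro j
    induction j with
    | zero => simp
    | succ j ih => rw [pow_succ a, ← mul_assoc, ih, mul_assoc, hab, ← mul_assoc, ← pow_succ]
  have hpow : ∀ j : ℕ, t ^ (n + j) * a ^ j = t ^ n := by
    intro j
    induction j with
    | zero => simp
    | succ j ih =>
      calc t ^ (n + (j + 1)) * a ^ (j + 1) = t ^ j * (t ^ (n + 1) * a) * a ^ j := by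
            rw [pow_succ' a, show n + (j + 1) = j + (n + 1) by omega, pow_add]
            simp only [mul_assoc]
        _ = t ^ n := by rw [← ha, ← pow_add, add_comm j n, ih]
  have hts : t * (t ^ n * a ^ (n + 1)) = t ^ n * a ^ n := by
    rw [pow_succ' a, ← mul_assoc, ← pow_succ', ← mul_assoc, ← ha]
  have hst : t ^ n * a ^ (n + 1) * t = t ^ n * a ^ n := by
    rw [hshift, hshift, mul_assoc, ← pow_succ, pow_succ b, mul_assoc, ← hb]
  refine ⟨t ^ n * a ^ (n + 1), hts.trans hst.symm, ?_, n, ?_⟩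
  · rw [hst, hshift n, mul_assoc, ← mul_assoc (t ^ n), ← pow_add, pow_succ a, ← mul_assoc (t ^ _),
      hpow, ← mul_assoc, ← hshift, mul_assoc, ← pow_succ]
  · rw [← mul_assoc, ← pow_add, show n + 1 + n = n + (n + 1) by omega, hpow]

theorem pow_succ_mul_eq_pow_of_le {t s : R} {k m : ℕ} (h : t ^ (k + 1) * s = t ^ k) (hkm : k ≤ m) :
    t ^ (m + 1) * s = t ^ m := by
  obtain ⟨j, rfl⟩ := Nat.exists_eq_add_of_le' hkm
  rw [add_assoc, pow_add, mul_assoc, h, ← pow_add]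

theorem pow_add_mul_pow_eq_pow {t s : R} {m : ℕ} (h : t ^ (m + 1) * s = t ^ m) (j : ℕ) :
    t ^ (m + j) * s ^ j = t ^ m := by
  induction j with
  | zero => simp
  | succ j ih =>
    rw [pow_succ' s, ← mul_assoc, ← add_assoc,
      pow_succ_mul_eq_pow_of_le h (Nat.le_add_right m j), ih]

end Ring

/-! ### Drazin inverses in a complex Banach algebra -/

section BanachAlgebra

variable {R : Type*} [NormedRing R] [NormedAlgebra ℂ R] [CompleteSpace R]

theorem eventually_isUnit_one_sub_smul (s : R) : ∀ᶠ z : ℂ in 𝓝 0, IsUnit (1 - z • s) := by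
  have hc : Tendsto (fun z : ℂ => 1 - z • s) (𝓝 0) (𝓝 1) := by
    have : Continuous (fun z : ℂ => 1 - z • s) := by fun_prop
    simpa using this.tendsto 0
  exact hc.eventually (Units.isOpen.mem_nhds isUnit_one)

/-- If `t` has Drazin inverse `s`, then `0` is at most an isolated point of the spectrum of `t`.
With the idempotent `p = 1 - t * s`, for which `t * p` is nilpotent and `s * (t * p) = 0`, one has
`(t - z) * (s - z⁻¹ p) = (1 - z s) * (1 - z⁻¹ t p)`, and both factors on the right are units for
small `z ≠ 0`. -/
theorem eventually_isUnit_sub_smul_one {t s : R} {k : ℕ} (hc : t * s = s * t)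
    (hs : s * t * s = s) (hk : t ^ (k + 1) * s = t ^ k) :
    ∀ᶠ z : ℂ in 𝓝[≠] 0, IsUnit (t - z • (1 : R)) := by
  have hcomm : Commute t (1 - t * s) :=
    (Commute.one_right t).sub_right ((Commute.refl t).mul_right hc)
  have hnil : IsNilpotent (t * (1 - t * s)) := by
    refine ⟨k + 1, ?_⟩
    have h0 : t ^ k * (1 - t * s) = 0 := by
      rw [mul_sub, ← mul_assoc, ← pow_succ, hk, mul_one, sub_self]
    rw [hcomm.mul_pow, pow_succ' t, pow_succ' (1 - t * s), ← mul_assoc, mul_assoc t, h0]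
    simp
  filter_upwards [(eventually_isUnit_one_sub_smul s).filter_mono nhdsWithin_le_nhds,
    self_mem_nhdsWithin] with z hz hz0
  have hz0 : z ≠ 0 := hz0
  have hnil' : IsUnit (1 - z⁻¹ • (t * (1 - t * s))) := (hnil.smul z⁻¹).isUnit_one_sub
  have hsp : s * (t * (1 - t * s)) = 0 := by
    rw [(hcomm : t * _ = _), ← mul_assoc, mul_sub, ← mul_assoc, hs, mul_one, sub_self, zero_mul]
  have hfac : (t - z • (1 : R)) * (s - z⁻¹ • (1 - t * s)) =
      (1 - z • s) * (1 - z⁻¹ • (t * (1 - t * s))) := by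
    have h1 : (1 - z • s) * (1 - z⁻¹ • (t * (1 - t * s))) =
        1 - z • s - z⁻¹ • (t * (1 - t * s)) := by
      rw [sub_mul, one_mul, mul_sub (z • s), mul_one, smul_mul_smul_comm, hsp, smul_zero, sub_zero]
      abel
    rw [h1, sub_mul, mul_sub, mul_smul_comm, smul_mul_assoc, one_mul, smul_sub, smul_smul,
      mul_inv_cancel₀ hz0, one_smul]
    abel
  have hcu : Commute (t - z • (1 : R)) (s - z⁻¹ • (1 - t * s)) := by
    have h1 : Commute t (s - z⁻¹ • (1 - t * s)) :=
      Commute.sub_right hc (hcomm.smul_right _)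
    exact h1.sub_left ((Commute.one_left _).smul_left z)
  exact (hcu.isUnit_mul_iff.1 (hfac ▸ hz.mul hnil')).1

/-- The Drazin inverse of `t` is a limit of products of powers of `t` and of its resolvent: since
`(t - z) * s * t ^ k = (1 - z s) * t ^ k` and `s ^ (k + 1) * t ^ k = s`, the product
`(t - z)⁻¹ ^ (k + 1) * t ^ k` equals `(1 - z s)⁻¹ ^ (k + 1) * s`. -/
theorem tendsto_inverse_pow_mul_pow {t s : R} {k : ℕ} (hc : t * s = s * t)
    (hs : s * t * s = s) (hk : t ^ (k + 1) * s = t ^ k) :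
    Tendsto (fun z : ℂ => Ring.inverse (t - z • (1 : R)) ^ (k + 1) * t ^ k) (𝓝[≠] 0) (𝓝 s) := by
  have hlim : Tendsto (fun z : ℂ => Ring.inverse (1 - z • s) ^ (k + 1) * s) (𝓝[≠] 0) (𝓝 s) := by
    have h1 : Tendsto (fun z : ℂ => 1 - z • s) (𝓝 0) (𝓝 ((1 : Rˣ) : R)) := by
      have : Continuous (fun z : ℂ => 1 - z • s) := by fun_prop
      simpa using this.tendsto 0
    have h2 := (((NormedRing.inverse_continuousAt (1 : Rˣ)).tendsto.comp h1).pow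
      (k + 1)).mul_const s
    simpa [Function.comp_def] using h2.mono_left nhdsWithin_le_nhds
  refine hlim.congr' ?_
  filter_upwards [(eventually_isUnit_one_sub_smul s).filter_mono nhdsWithin_le_nhds,
    eventually_isUnit_sub_smul_one hc hs hk] with z hv hu
  have hsk : ∀ j : ℕ, s ^ (j + 1) * t ^ j = s := by
    intro j
    induction j with
    | zero => simp
    | succ j ih =>
      rw [pow_succ' s, pow_succ t, mul_assoc, ← mul_assoc (s ^ _), ih, ← hc, ← mul_assoc, hs]
  have hcts : Commute t s := hc
  have huS : Commute (t - z • (1 : R)) s := hcts.sub_left ((Commute.one_left s).smul_left z)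
  have hvt : Commute (1 - z • s) t := (Commute.one_left t).sub_left (hcts.symm.smul_left z)
  have huv : Commute (t - z • (1 : R)) (1 - z • s) :=
    (Commute.one_right _).sub_right (huS.smul_right z)
  have hbase : (t - z • (1 : R)) * s * t ^ k = (1 - z • s) * t ^ k := by
    rw [sub_mul, sub_mul, sub_mul, one_mul, smul_mul_assoc, one_mul, mul_assoc t,
      ← (hcts.pow_left k).eq, ← mul_assoc, ← pow_succ', hk]
  have hiter : ∀ j : ℕ, ((t - z • (1 : R)) * s) ^ j * t ^ k = (1 - z • s) ^ j * t ^ k := by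
    intro j
    induction j with
    | zero => simp
    | succ j ih =>
      rw [pow_succ, mul_assoc, hbase, (hvt.pow_right k).eq, ← mul_assoc, ih, mul_assoc,
        ← (hvt.pow_right k).eq, ← mul_assoc, ← pow_succ]
  have hkey : (t - z • (1 : R)) ^ (k + 1) * s = (1 - z • s) ^ (k + 1) * t ^ k := by
    rw [← hiter, huS.mul_pow, mul_assoc, hsk]
  obtain ⟨u, hu⟩ := hu
  obtain ⟨v, hv⟩ := hv
  rw [← hu, ← hv] at hkey huv
  rw [← hu, ← hv, Ring.inverse_unit, Ring.inverse_unit, ← Units.val_pow_eq_pow_val,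
    ← Units.val_pow_eq_pow_val, inv_pow, inv_pow, Units.inv_mul_eq_iff_eq_mul]
  have hcomm : Commute (((u ^ (k + 1))⁻¹ : Rˣ) : R) ((v ^ (k + 1) : Rˣ) : R) := by
    refine Commute.units_inv_left ?_
    simpa using huv.pow_pow (k + 1) (k + 1)
  rw [← mul_assoc, ← hcomm.eq, mul_assoc, Units.eq_inv_mul_iff_mul_eq]
  simpa using hkey

end BanachAlgebra

/-! ### The single valued extension property -/

section SVEP

variable {X : Type*} [NormedAddCommGroup X] [NormedSpace ℂ X]

theorem hasSVEPAt_of_eventually_injective {T : X →L[ℂ] X} {z : ℂ}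
    (h : ∀ᶠ μ in 𝓝[≠] z, ∀ x, (T - μ • ContinuousLinearMap.id ℂ X) x = 0 → x = 0) :
    HasSVEPAt T z := by
  rw [eventually_nhdsWithin_iff, Metric.eventually_nhds_iff_ball] at h
  obtain ⟨r, hr, h⟩ := h
  refine ⟨r, hr, fun V hV hVr f hf hT => ?_⟩
  have hne : ∀ μ ∈ V, μ ≠ z → f μ = 0 := fun μ hμ hμz =>
    h μ (hVr hμ) hμz (f μ) (hT μ hμ)
  intro μ hμ
  by_cases hμz : μ = z
  · have h0 : Tendsto f (𝓝[≠] μ) (𝓝 (f μ)) :=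
      (hf μ hμ).continuousAt.tendsto.mono_left nhdsWithin_le_nhds
    refine tendsto_nhds_unique h0 (tendsto_const_nhds.congr' ?_)
    filter_upwards [self_mem_nhdsWithin, nhdsWithin_le_nhds (hV.mem_nhds hμ)] with w hw hwV
    exact (hne w hwV (hμz ▸ hw)).symm
  · exact hne μ hμ hμz

variable [CompleteSpace X]

theorem eventually_isUnit_sub_smul_id {T : X →L[ℂ] X} {z : ℂ}
    (h : IsDrazinInvertible (T - z • ContinuousLinearMap.id ℂ X)) :
    ∀ᶠ μ in 𝓝[≠] z, IsUnit (T - μ • ContinuousLinearMap.id ℂ X) := by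
  obtain ⟨S, hc, hs, k, hk⟩ := h
  have h1 := eventually_isUnit_sub_smul_one hc hs hk
  have ht : Tendsto (fun μ : ℂ => μ - z) (𝓝[≠] z) (𝓝[≠] 0) := by
    refine tendsto_nhdsWithin_iff.2 ⟨?_, ?_⟩
    · have : Continuous (fun μ : ℂ => μ - z) := by fun_prop
      simpa using (this.tendsto z).mono_left nhdsWithin_le_nhds
    · filter_upwards [self_mem_nhdsWithin] with μ hμ
      exact sub_ne_zero.2 hμ
  filter_upwards [ht.eventually h1] with μ hμ
  convert hμ using 1
  rw [ContinuousLinearMap.one_def, sub_smul]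
  abel

/-- Near a point at which `T` has the SVEP, `T - μ` is injective wherever it has a right inverse. -/
theorem HasSVEPAt.eventually_eq_zero {T : X →L[ℂ] X} {z : ℂ} (h : HasSVEPAt T z) :
    ∀ᶠ μ in 𝓝 z, ∀ R : X →L[ℂ] X, (T - μ • ContinuousLinearMap.id ℂ X) * R = 1 →
      ∀ x, (T - μ • ContinuousLinearMap.id ℂ X) x = 0 → x = 0 := by
  obtain ⟨r, hr, h⟩ := h
  filter_upwards [Metric.ball_mem_nhds z hr] with μ₀ hμ₀ R hR x hx
  have hcont : Continuous (fun μ : ℂ => 1 - (μ - μ₀) • R) := by fun_prop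
  have hopen : IsOpen (Metric.ball z r ∩ {μ : ℂ | IsUnit (1 - (μ - μ₀) • R)}) :=
    Metric.isOpen_ball.inter (Units.isOpen.preimage hcont)
  -- `(T - μ₀) (1 - (μ - μ₀) R) = T - μ`, so `(1 - (μ - μ₀) R)⁻¹ x` is a solution with
  -- value `x` at `μ₀`.
  have hres := h _ hopen Set.inter_subset_left
    (fun μ => Ring.inverse (1 - (μ - μ₀) • R) x) ?_ ?_ μ₀ ⟨hμ₀, by simp⟩
  · simpa using hres
  · rintro μ ⟨-, u, hu⟩
    have h1 : AnalyticAt ℂ (fun μ : ℂ => 1 - (μ - μ₀) • R) μ := by fun_prop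
    have h2 : AnalyticAt ℂ Ring.inverse (1 - (μ - μ₀) • R) := hu ▸ analyticAt_inverse u
    have h3 : AnalyticAt ℂ (fun μ : ℂ => Ring.inverse (1 - (μ - μ₀) • R)) μ :=
      AnalyticAt.comp (f := fun μ : ℂ => 1 - (μ - μ₀) • R) h2 h1
    exact ((ContinuousLinearMap.apply ℂ X x).analyticAt _).comp h3
  · rintro μ ⟨-, hu⟩
    have hfac : T - μ • ContinuousLinearMap.id ℂ X =
        (T - μ₀ • ContinuousLinearMap.id ℂ X) * (1 - (μ - μ₀) • R) := by
      rw [mul_sub, mul_one, mul_smul_comm, hR, sub_smul, ContinuousLinearMap.one_def]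
      abel
    rw [hfac, ← mul_apply_eq_comp, mul_assoc, Ring.mul_inverse_cancel _ hu, mul_one, hx]

end SVEP

/-! ### Dual operators -/

section Dual

variable {X : Type*} [NormedAddCommGroup X] [NormedSpace ℂ X]

theorem dualOperator_sub_smul_id (T : X →L[ℂ] X) (z : ℂ) :
    dualOperator T - z • ContinuousLinearMap.id ℂ (StrongDual ℂ X) =
      dualOperator (T - z • ContinuousLinearMap.id ℂ X) := by
  ext φ x
  simp [dualOperator]

theorem dualOperator_mul (T S : X →L[ℂ] X) :
    dualOperator (T * S) = dualOperator S * dualOperator T := by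
  ext φ x
  simp [dualOperator]

theorem dualOperator_one : dualOperator (1 : X →L[ℂ] X) = 1 := by
  ext φ x
  simp [dualOperator]

/-- A left inverse of `T` is two-sided if the dual of `T` is injective: every functional `φ`
satisfies `T* (φ ∘ (1 - T P)) = 0`, so `φ ∘ (1 - T P) = 0`, and functionals separate points. -/
theorem mul_eq_one_of_dualOperator_injective {T P : X →L[ℂ] X} (hPT : P * T = 1)
    (h : ∀ φ, dualOperator T φ = 0 → φ = 0) : T * P = 1 := by
  ext x
  refine (SeparatingDual.eq_iff_forall_dual_eq (R := ℂ)).2 fun φ => ?_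
  have h1 : φ.comp (1 - T * P) = 0 := by
    apply h
    have h2 : (1 - T * P) * T = 0 := by rw [sub_mul, mul_assoc, hPT, one_mul, mul_one, sub_self]
    ext y
    have h3 := congrArg (fun Q : X →L[ℂ] X => φ (Q y)) h2
    simpa [dualOperator] using h3
  have h4 := congrArg (fun ψ : StrongDual ℂ X => ψ x) h1
  exact (sub_eq_zero.1 (by simpa using h4)).symm

end Dual

/-! ### Upper triangular operator matrices -/

section OperatorMatrix

variable {X Y : Type*} [NormedAddCommGroup X] [NormedSpace ℂ X]
  [NormedAddCommGroup Y] [NormedSpace ℂ Y]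

@[simp]
theorem operatorMatrix_apply (A : X →L[ℂ] X) (C : Y →L[ℂ] X) (B : Y →L[ℂ] Y) (p : X × Y) :
    operatorMatrix A C B p = (A p.1 + C p.2, B p.2) := rfl

theorem operatorMatrix_sub_smul_id (A : X →L[ℂ] X) (C : Y →L[ℂ] X) (B : Y →L[ℂ] Y) (z : ℂ) :
    operatorMatrix A C B - z • ContinuousLinearMap.id ℂ (X × Y) =
      operatorMatrix (A - z • ContinuousLinearMap.id ℂ X) C
        (B - z • ContinuousLinearMap.id ℂ Y) := by
  refine ContinuousLinearMap.ext fun p => Prod.ext ?_ ?_ <;> simp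
  abel

theorem operatorMatrix_mul (A A' : X →L[ℂ] X) (C C' : Y →L[ℂ] X) (B B' : Y →L[ℂ] Y) :
    operatorMatrix A C B * operatorMatrix A' C' B' =
      operatorMatrix (A * A') (A.comp C' + C.comp B') (B * B') := by
  refine ContinuousLinearMap.ext fun p => Prod.ext ?_ ?_ <;> simp
  abel

theorem operatorMatrix_add (A A' : X →L[ℂ] X) (C C' : Y →L[ℂ] X) (B B' : Y →L[ℂ] Y) :
    operatorMatrix A C B + operatorMatrix A' C' B' =
      operatorMatrix (A + A') (C + C') (B + B') := by
  refine ContinuousLinearMap.ext fun p => Prod.ext ?_ ?_ <;> simp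
  abel

theorem operatorMatrix_one : operatorMatrix (1 : X →L[ℂ] X) 0 (1 : Y →L[ℂ] Y) = 1 := by
  refine ContinuousLinearMap.ext fun p => Prod.ext ?_ ?_ <;> simp

theorem exists_operatorMatrix_pow (A : X →L[ℂ] X) (C : Y →L[ℂ] X) (B : Y →L[ℂ] Y) (n : ℕ) :
    ∃ D : Y →L[ℂ] X, operatorMatrix A C B ^ n = operatorMatrix (A ^ n) D (B ^ n) := by
  induction n with
  | zero => exact ⟨0, by simp [operatorMatrix_one]⟩
  | succ n ih =>
    obtain ⟨D, hD⟩ := ih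
    exact ⟨_, by rw [pow_succ, hD, operatorMatrix_mul, ← pow_succ, ← pow_succ]⟩

theorem operatorMatrix_inj {A A' : X →L[ℂ] X} {C C' : Y →L[ℂ] X} {B B' : Y →L[ℂ] Y}
    (h : operatorMatrix A C B = operatorMatrix A' C' B') : A = A' ∧ C = C' ∧ B = B' := by
  have hp := fun p => congrArg (fun T : (X × Y) →L[ℂ] (X × Y) => T p) h
  refine ⟨?_, ?_, ?_⟩ <;> ext v
  · simpa using hp (v, 0)
  · exact (by simpa using hp (0, v) : C v = C' v ∧ _).1
  · exact (by simpa using hp (0, v) : _ ∧ B v = B' v).2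

theorem exists_eq_operatorMatrix {T : (X × Y) →L[ℂ] (X × Y)} (h : ∀ x, (T (x, 0)).2 = 0) :
    ∃ A C B, T = operatorMatrix A C B := by
  refine ⟨(ContinuousLinearMap.fst ℂ X Y).comp (T.comp (ContinuousLinearMap.inl ℂ X Y)),
    (ContinuousLinearMap.fst ℂ X Y).comp (T.comp (ContinuousLinearMap.inr ℂ X Y)),
    (ContinuousLinearMap.snd ℂ X Y).comp (T.comp (ContinuousLinearMap.inr ℂ X Y)), ?_⟩
  refine ContinuousLinearMap.ext fun p => ?_
  have hp : T p = T (p.1, 0) + T (0, p.2) := by rw [← map_add]; simp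
  rw [hp]
  refine Prod.ext ?_ ?_ <;> simp [h]

/-- For Drazin inverses `S` of `A` and `S'` of `B`, and `M` the operator matrix, both
`M ^ m - M ^ (m + 1) * diag(S, S')` and `M ^ m - diag(S, S') * M ^ (m + 1)` have only an upper right
entry for large `m`. Multiplied by `M ^ m`, such an error is itself a multiple of `M ^ (2 m + 1)`. -/
theorem isDrazinInvertible_operatorMatrix {A : X →L[ℂ] X} {B : Y →L[ℂ] Y} (C : Y →L[ℂ] X)
    (hA : IsDrazinInvertible A) (hB : IsDrazinInvertible B) :
    IsDrazinInvertible (operatorMatrix A C B) := by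
  obtain ⟨S, hSc, -, k, hSk⟩ := hA
  obtain ⟨S', hSc', -, l, hSl⟩ := hB
  set m := max k l
  have hm : A ^ (m + 1) * S = A ^ m := pow_succ_mul_eq_pow_of_le hSk (le_max_left k l)
  have hm' : B ^ (m + 1) * S' = B ^ m := pow_succ_mul_eq_pow_of_le hSl (le_max_right k l)
  have hcomm : S * A ^ (m + 1) = A ^ (m + 1) * S := ((show Commute A S from hSc).pow_left _).eq.symm
  have hcomm' : S' * B ^ (m + 1) = B ^ (m + 1) * S' :=
    ((show Commute B S' from hSc').pow_left _).eq.symm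
  obtain ⟨D, hD⟩ := exists_operatorMatrix_pow A C B m
  obtain ⟨E, hE⟩ := exists_operatorMatrix_pow A C B (m + 1)
  obtain ⟨F, hF⟩ := exists_operatorMatrix_pow A C B (m + m + 1)
  set M := operatorMatrix A C B
  have hr : M ^ m = M ^ (m + 1) * operatorMatrix S 0 S' +
      operatorMatrix 0 (D - E.comp S') 0 := by
    rw [hD, hE, operatorMatrix_mul, operatorMatrix_add, hm, hm']
    simp
  have hl : M ^ m = operatorMatrix S 0 S' * M ^ (m + 1) +
      operatorMatrix 0 (D - S.comp E) 0 := by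
    rw [hD, hE, operatorMatrix_mul, operatorMatrix_add, hcomm, hcomm', hm, hm']
    simp
  have hA' : A ^ (m + m + 1) * S ^ (m + 1) = A ^ m := pow_add_mul_pow_eq_pow hm (m + 1)
  have hB' : S' ^ (m + 1) * B ^ (m + m + 1) = B ^ m := by
    rw [← ((show Commute B S' from hSc').pow_pow _ _).eq]
    exact pow_add_mul_pow_eq_pow hm' (m + 1)
  refine exists_drazin_inverse_of_pow_eq (n := m + m)
    (a := operatorMatrix S 0 S' + operatorMatrix 0 ((S ^ (m + 1)).comp (D - E.comp S')) 0)
    (b := operatorMatrix S 0 S' + operatorMatrix 0 ((D - S.comp E).comp (S' ^ (m + 1))) 0) ?_ ?_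
  · have h1 : M ^ m * operatorMatrix 0 (D - E.comp S') 0 =
        M ^ (m + m + 1) * operatorMatrix 0 ((S ^ (m + 1)).comp (D - E.comp S')) 0 := by
      rw [hD, hF, operatorMatrix_mul, operatorMatrix_mul, ← ContinuousLinearMap.comp_assoc,
        ← ContinuousLinearMap.mul_def (A ^ _), hA']
      simp
    rw [mul_add, ← h1, add_assoc m m 1, pow_add M m (m + 1), mul_assoc, ← mul_add, ← hr, pow_add]
  · have h1 : operatorMatrix 0 (D - S.comp E) 0 * M ^ m =
        operatorMatrix 0 ((D - S.comp E).comp (S' ^ (m + 1))) 0 * M ^ (m + m + 1) := by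
      rw [hD, hF, operatorMatrix_mul, operatorMatrix_mul, ContinuousLinearMap.comp_assoc,
        ← ContinuousLinearMap.mul_def (S' ^ _), hB']
      simp
    rw [add_mul, ← h1, show m + m + 1 = m + 1 + m by omega, pow_add M (m + 1) m, ← mul_assoc,
      ← add_mul, ← hl, pow_add]

/-- If an upper triangular operator matrix is invertible (with an inverse that need not be upper
triangular), then `A` has a left inverse and `B` a right inverse. -/
theorem exists_left_right_inverse {A : X →L[ℂ] X} {C : Y →L[ℂ] X} {B : Y →L[ℂ] Y}
    (h : IsUnit (operatorMatrix A C B)) :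
    (∃ P : X →L[ℂ] X, P * A = 1) ∧ ∃ R : Y →L[ℂ] Y, B * R = 1 := by
  obtain ⟨N, hMN, hNM⟩ := isUnit_iff_exists.1 h
  refine ⟨⟨(ContinuousLinearMap.fst ℂ X Y).comp (N.comp (ContinuousLinearMap.inl ℂ X Y)), ?_⟩,
    ⟨(ContinuousLinearMap.snd ℂ X Y).comp (N.comp (ContinuousLinearMap.inr ℂ X Y)), ?_⟩⟩
  · ext x
    have h1 := congrArg (fun T : (X × Y) →L[ℂ] (X × Y) => (T (x, 0)).1) hNM
    simpa using h1
  · ext y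
    have h1 := congrArg (fun T : (X × Y) →L[ℂ] (X × Y) => (T (0, y)).2) hMN
    simpa using h1

theorem inverse_operatorMatrix_apply_inl_snd_eq_zero {A : X →L[ℂ] X} {C : Y →L[ℂ] X} {B : Y →L[ℂ] Y}
    (h : IsUnit (operatorMatrix A C B)) (hB : ∀ y, B y = 0 → y = 0) (x : X) :
    (Ring.inverse (operatorMatrix A C B) (x, 0)).2 = 0 := by
  apply hB
  have h1 := congrArg (fun T : (X × Y) →L[ℂ] (X × Y) => (T (x, 0)).2) (Ring.mul_inverse_cancel _ h)
  simpa using h1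

/-- In an invertible operator matrix whose entry `A` is right invertible, `B` is injective: a kernel
vector `y` of `B` gives the kernel vector `(-P (C y), y)` of the matrix. -/
theorem eq_zero_of_isUnit_operatorMatrix {A P : X →L[ℂ] X} {C : Y →L[ℂ] X} {B : Y →L[ℂ] Y}
    (h : IsUnit (operatorMatrix A C B)) (hAP : A * P = 1) (y : Y) (hy : B y = 0) : y = 0 := by
  have hA : ∀ x, A (P x) = x := fun x => congrArg (fun T : X →L[ℂ] X => T x) hAP
  have h0 : operatorMatrix A C B (-P (C y), y) = 0 := by simp [hA, hy]
  have h1 := congrArg (fun T : (X × Y) →L[ℂ] (X × Y) => T (-P (C y), y))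
    (Ring.inverse_mul_cancel _ h)
  have h2 : ((-P (C y), y) : X × Y) = 0 := by
    simpa only [mul_apply_eq_comp, h0, map_zero, one_apply_eq_self,
      eq_comm] using h1
  exact congrArg Prod.snd h2

variable [CompleteSpace X] [CompleteSpace Y]

/-- If the resolvent of an operator matrix is upper triangular near `0`, which injectivity of
`B - z` ensures, then its Drazin inverse is upper triangular, and the diagonal entries of that are
Drazin inverses of `A` and `B`. -/
theorem isDrazinInvertible_of_operatorMatrix {A : X →L[ℂ] X} {C : Y →L[ℂ] X} {B : Y →L[ℂ] Y}
    (hM : IsDrazinInvertible (operatorMatrix A C B))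
    (hB : ∀ᶠ z : ℂ in 𝓝[≠] 0, ∀ y, (B - z • ContinuousLinearMap.id ℂ Y) y = 0 → y = 0) :
    IsDrazinInvertible A ∧ IsDrazinInvertible B := by
  obtain ⟨S, hc, hs, k, hk⟩ := hM
  have hS : ∀ x, (S (x, 0)).2 = 0 := by
    intro x
    have hcont : Continuous (fun T : (X × Y) →L[ℂ] (X × Y) => (T (x, 0)).2) := by fun_prop
    refine tendsto_nhds_unique ((hcont.tendsto S).comp (tendsto_inverse_pow_mul_pow hc hs hk))
      (tendsto_const_nhds.congr' ?_)
    filter_upwards [eventually_isUnit_sub_smul_one hc hs hk, hB] with z hz hBz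
    rw [ContinuousLinearMap.one_def, operatorMatrix_sub_smul_id] at hz
    obtain ⟨A', C', B', hinv⟩ :=
      exists_eq_operatorMatrix (inverse_operatorMatrix_apply_inl_snd_eq_zero hz hBz)
    obtain ⟨D, hD⟩ := exists_operatorMatrix_pow A' C' B' (k + 1)
    obtain ⟨E, hE⟩ := exists_operatorMatrix_pow A C B k
    simp only [Function.comp_apply]
    rw [ContinuousLinearMap.one_def, operatorMatrix_sub_smul_id, hinv, hD, hE, operatorMatrix_mul]
    simp
  obtain ⟨S₁, S₂, S₃, rfl⟩ := exists_eq_operatorMatrix hS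
  obtain ⟨D, hD⟩ := exists_operatorMatrix_pow A C B k
  obtain ⟨E, hE⟩ := exists_operatorMatrix_pow A C B (k + 1)
  rw [hD, hE, operatorMatrix_mul] at hk
  rw [operatorMatrix_mul, operatorMatrix_mul] at hc hs
  obtain ⟨hc₁, -, hc₃⟩ := operatorMatrix_inj hc
  obtain ⟨hs₁, -, hs₃⟩ := operatorMatrix_inj hs
  obtain ⟨hk₁, -, hk₃⟩ := operatorMatrix_inj hk
  exact ⟨⟨S₁, hc₁, hs₁, k, hk₁⟩, ⟨S₃, hc₃, hs₃, k, hk₃⟩⟩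

theorem isDrazinInvertible_of_operatorMatrix_of_hasSVEPAt
    {A : X →L[ℂ] X} {C : Y →L[ℂ] X} {B : Y →L[ℂ] Y} {z : ℂ}
    (hM : IsDrazinInvertible (operatorMatrix A C B - z • ContinuousLinearMap.id ℂ (X × Y)))
    (h : HasSVEPAt (dualOperator A) z ∨ HasSVEPAt B z) :
    IsDrazinInvertible (A - z • ContinuousLinearMap.id ℂ X) ∧
      IsDrazinInvertible (B - z • ContinuousLinearMap.id ℂ Y) := by
  have hunit := eventually_isUnit_sub_smul_id hM
  have hinj : ∀ᶠ μ in 𝓝[≠] z, ∀ y, (B - μ • ContinuousLinearMap.id ℂ Y) y = 0 → y = 0 := by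
    rcases h with h | h
    · filter_upwards [hunit, h.eventually_eq_zero.filter_mono nhdsWithin_le_nhds] with μ hμ hA
      rw [operatorMatrix_sub_smul_id] at hμ
      obtain ⟨⟨P, hP⟩, -⟩ := exists_left_right_inverse hμ
      rw [dualOperator_sub_smul_id] at hA
      refine eq_zero_of_isUnit_operatorMatrix hμ (mul_eq_one_of_dualOperator_injective hP
        (hA (dualOperator P) ?_))
      rw [← dualOperator_mul, hP, dualOperator_one]
    · filter_upwards [hunit, h.eventually_eq_zero.filter_mono nhdsWithin_le_nhds] with μ hμ hB
      rw [operatorMatrix_sub_smul_id] at hμ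
      obtain ⟨-, R, hR⟩ := exists_left_right_inverse hμ
      exact hB R hR
  rw [operatorMatrix_sub_smul_id] at hM
  refine isDrazinInvertible_of_operatorMatrix hM ?_
  have ht : Tendsto (fun w : ℂ => z + w) (𝓝[≠] 0) (𝓝[≠] z) := by
    refine tendsto_nhdsWithin_iff.2 ⟨?_, ?_⟩
    · have : Continuous (fun w : ℂ => z + w) := by fun_prop
      simpa using (this.tendsto 0).mono_left nhdsWithin_le_nhds
    · filter_upwards [self_mem_nhdsWithin] with w hw
      simpa using hw
  filter_upwards [ht.eventually hinj] with w hw y hy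
  refine hw y ?_
  rw [← hy, add_smul, sub_add_eq_sub_sub]

end OperatorMatrix

end UpperTriangular

theorem theorem3p1 {X Y : Type*}
    [NormedAddCommGroup X] [NormedSpace ℂ X] [CompleteSpace X]
    [NormedAddCommGroup Y] [NormedSpace ℂ Y] [CompleteSpace Y]
    (A : X →L[ℂ] X) (B : Y →L[ℂ] Y) (C : Y →L[ℂ] X) :
    UpperTriangular.drazinSpectrum (UpperTriangular.operatorMatrix A C B) ∪
        (UpperTriangular.svepFailureSet (UpperTriangular.dualOperator A) ∩
          UpperTriangular.svepFailureSet B) =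
      UpperTriangular.drazinSpectrum A ∪ UpperTriangular.drazinSpectrum B := by
  open UpperTriangular in
  ext z
  simp only [drazinSpectrum, svepFailureSet, Set.mem_union, Set.mem_inter_iff, Set.mem_ofPred_eq]
  constructor
  · intro h
    by_contra! hAB
    obtain ⟨hA, hB⟩ := hAB
    rcases h with hM | ⟨-, hS⟩
    · rw [operatorMatrix_sub_smul_id] at hM
      exact hM (isDrazinInvertible_operatorMatrix C hA hB)
    · refine hS (hasSVEPAt_of_eventually_injective ?_)
      filter_upwards [eventually_isUnit_sub_smul_id hB] with μ hμ
      exact (injective_iff_map_eq_zero _).1 (ContinuousLinearMap.isUnit_iff_bijective.1 hμ).1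
  · intro h
    by_contra! hM
    obtain ⟨hM, hS⟩ := hM
    have hAB := isDrazinInvertible_of_operatorMatrix_of_hasSVEPAt hM
      (by by_cases hA : HasSVEPAt (dualOperator A) z
          · exact Or.inl hA
          · exact Or.inr (hS hA))
    exact h.elim (fun h => h hAB.1) (fun h => h hAB.2)
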